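/- Let $p$ be a prime, let $k$ be an algebraically closed field of characteristic $p$, and let $\mathcal{O}$ be either $k$ or the ring $W(k)$ of Witt vectors of $k$. For $q$ a power of $p$, the automorphism $\lambda\mapsto\lambda^q$ of $k$ lifts uniquely to a ring automorphism of $W(k)$; in both cases denote the inverse of the resulting automorphism of $\mathcal{O}$ by $\mu\mapsto\mu^{1/q}$. For an $\mathcal{O}$-algebra $A$, the Frobenius twist $A^{(q)}$ is the $\mathcal{O}$-algebra that equals $A$ as a ring, with scalar multiplication $\lambda\cdot a=\lambda^{1/q}a$ for $\lambda\in\mathcal{O}$, $a\in A$. Let $P$ be a finite abelian $p$-group, $L$ an abelian subgroup of $\mathrm{Aut}(P)$ of order prime to $p$, and $\alpha\in H^2(L,\mathcal{O}^\times)$, where $L$ acts trivially on $\mathcal{O}^\times$. Let $\mathcal{O}_\alpha(P\rtimes L)$ be the corresponding twisted group algebra: the free $\mathcal{O}$-module with basis $\{[x] : x\in P\rtimes L\}$ and $\mathcal{O}$-bilinear multiplication $[x][y]=c(x,y)[xy]$, where $c$ is any 2-cocycle representing the inflation of $\alpha$ along the projection $P\rtimes L\to L$. Then there is an isomorphism of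 $\mathcal{O}$-algebras $$\mathcal{O}_\alpha(P\rtimes L)\;\cong\;\mathcal{O}_\alpha(P\rtimes L)^{(p^2)}.$$ -/

import Mathlib

noncomputable section

/-! ### Second group cohomology with trivial coefficients -/

namespace TrivCoeff

/-- The group `Z²(G, M)` of 2-cocycles of `G` with values in the abelian group `M`, on which `G`
acts trivially. Cocycles are not assumed to be normalised. -/
def Z2 (G M : Type*) [Group G] [CommGroup M] : Subgroup (G → G → M) where
  carrier := {c | ∀ x y z, c x y * c (x * y) z = c y z * c x (y * z)}
  one_mem' := fun _ _ _ => rfl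
  mul_mem' := fun {a b} ha hb x y z => by
    simp only [Pi.mul_apply]
    rw [mul_mul_mul_comm, ha x y z, hb x y z, mul_mul_mul_comm]
  inv_mem' := fun {a} ha x y z => by
    simp only [Pi.inv_apply]
    rw [← mul_inv, ha x y z, mul_inv]

/-- The coboundary map, sending `f : G → M` to `(x, y) ↦ f x * f y * (f (x * y))⁻¹`. -/
def d1 (G M : Type*) [Group G] [CommGroup M] : (G → M) →* Z2 G M where
  toFun f := ⟨fun x y => f x * f y * (f (x * y))⁻¹, fun x y z => by
    simp only [mul_assoc x y z]
    calc f x * f y * (f (x * y))⁻¹ * (f (x * y) * f z * (f (x * (y * z)))⁻¹)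
        = f x * f y * f z * (f (x * (y * z)))⁻¹ := by group
      _ = f x * (f y * f z) * (f (x * (y * z)))⁻¹ := by group
      _ = f y * f z * f x * (f (x * (y * z)))⁻¹ := by rw [mul_comm (f x)]
      _ = f y * f z * (f (y * z))⁻¹ * (f x * f (y * z) * (f (x * (y * z)))⁻¹) := by
        rw [mul_comm (f x) (f (y * z))]; group⟩
  map_one' := by ext; simp
  map_mul' f g := by
    ext x y
    simp only [Pi.mul_apply, Subgroup.coe_mul, mul_inv]
    rw [mul_mul_mul_comm (f x), mul_mul_mul_comm (f x * f y)]

/-- The second cohomology group `H²(G, M) = Z²(G, M) / B²(G, M)`, with `G` acting trivially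
on `M`. -/
abbrev H2 (G M : Type*) [Group G] [CommGroup M] : Type _ := Z2 G M ⧸ (d1 G M).range

/-- Pull-back of 2-cocycles along a group homomorphism. -/
def Z2.comap {G H : Type*} (M : Type*) [Group G] [Group H] [CommGroup M] (f : G →* H) :
    Z2 H M →* Z2 G M where
  toFun c := ⟨fun x y => c.1 (f x) (f y), fun x y z => by
    simpa only [map_mul] using c.2 (f x) (f y) (f z)⟩
  map_one' := rfl
  map_mul' _ _ := rfl

/-- The map `H²(H, M) → H²(G, M)` induced by a group homomorphism `G → H`; it is inflation when
the homomorphism is surjective. -/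
def H2.comap {G H : Type*} (M : Type*) [Group G] [Group H] [CommGroup M] (f : G →* H) :
    H2 H M →* H2 G M :=
  QuotientGroup.map _ _ (Z2.comap M f) (by
    rintro _ ⟨g, rfl⟩
    exact ⟨g ∘ f, by ext x y; simp [d1, Z2.comap]⟩)

end TrivCoeff

/-! ### Twisted group algebras -/

/-- The twisted group algebra `R_c G` of a group `G` over a commutative ring `R` with respect to a
2-cocycle `c : G × G → Rˣ`: the free `R`-module on symbols `[x]`, `x ∈ G`, with the `R`-bilinear
multiplication such that `[x] * [y] = c(x, y) [xy]`. -/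
def TwistedGroupAlgebra {G R : Type*} [Group G] [CommRing R] (_c : TrivCoeff.Z2 G Rˣ) : Type _ :=
  G →₀ R

namespace TwistedGroupAlgebra

open TrivCoeff

variable {G R : Type*} [Group G] [CommRing R] (c : Z2 G Rˣ)

instance : AddCommGroup (TwistedGroupAlgebra c) := inferInstanceAs (AddCommGroup (G →₀ R))

instance : Module R (TwistedGroupAlgebra c) := inferInstanceAs (Module R (G →₀ R))

/-- The basis element `[x]` of the twisted group algebra. -/
def of (x : G) : TwistedGroupAlgebra c := Finsupp.single x (1 : R)

/-- The multiplication of the twisted group algebra, as the bilinear map that sends `[x], [y]`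
to `c(x, y) [xy]`. -/
def mulBilin : TwistedGroupAlgebra c →ₗ[R] TwistedGroupAlgebra c →ₗ[R] TwistedGroupAlgebra c :=
  Finsupp.linearCombination R fun x : G =>
    (Finsupp.linearCombination R fun y : G => (c.1 x y : R) • of c (x * y) :
      TwistedGroupAlgebra c →ₗ[R] TwistedGroupAlgebra c)

instance : Mul (TwistedGroupAlgebra c) := ⟨fun a b => mulBilin c a b⟩

/-- The identity element is `c(1, 1)⁻¹ [1]`. -/
instance : One (TwistedGroupAlgebra c) := ⟨(((c.1 1 1)⁻¹ : Rˣ) : R) • of c 1⟩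

variable {c}

theorem mul_def (a b : TwistedGroupAlgebra c) : a * b = mulBilin c a b := rfl

theorem one_def : (1 : TwistedGroupAlgebra c) = (((c.1 1 1)⁻¹ : Rˣ) : R) • of c 1 := rfl

theorem of_mul_of (x y : G) : of c x * of c y = (c.1 x y : R) • of c (x * y) := by
  rw [mul_def, mulBilin, of, of]
  erw [Finsupp.linearCombination_single, one_smul, Finsupp.linearCombination_single, one_smul]

/-- Linear maps on the twisted group algebra that agree on all `[x]` are equal. -/
theorem hom_ext {M : Type*} [AddCommGroup M] [Module R M]
    {f g : TwistedGroupAlgebra c →ₗ[R] M} (h : ∀ x, f (of c x) = g (of c x)) : f = g :=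
  Finsupp.lhom_ext' fun x => LinearMap.ext_ring (h x)

theorem one_mul' (a : TwistedGroupAlgebra c) : 1 * a = a := by
  suffices h : mulBilin c 1 = LinearMap.id from LinearMap.congr_fun h a
  refine hom_ext fun x => ?_
  have h1 : c.1 1 x = c.1 1 1 := by
    have := c.2 1 1 x
    simpa using this.symm
  rw [one_def, map_smul, LinearMap.smul_apply, ← mul_def, of_mul_of, h1, smul_smul, one_mul,
    Units.inv_mul, one_smul, LinearMap.id_apply]

theorem mul_one' (a : TwistedGroupAlgebra c) : a * 1 = a := by
  suffices h : (mulBilin c).flip 1 = LinearMap.id from LinearMap.congr_fun h a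
  refine hom_ext fun x => ?_
  have h1 : c.1 x 1 = c.1 1 1 := by
    have := c.2 x 1 1
    simpa using this
  rw [LinearMap.flip_apply, one_def, map_smul, ← mul_def, of_mul_of, h1, smul_smul, mul_one,
    Units.inv_mul, one_smul, LinearMap.id_apply]

theorem smul_mul' (r : R) (a b : TwistedGroupAlgebra c) : (r • a) * b = r • (a * b) := by
  simp only [mul_def, map_smul, LinearMap.smul_apply]

theorem mul_smul' (r : R) (a b : TwistedGroupAlgebra c) : a * (r • b) = r • (a * b) := by
  simp only [mul_def, map_smul]

theorem add_mul' (a b d : TwistedGroupAlgebra c) : (a + b) * d = a * d + b * d := by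
  simp only [mul_def, map_add, LinearMap.add_apply]

theorem mul_add' (a b d : TwistedGroupAlgebra c) : a * (b + d) = a * b + a * d := by
  simp only [mul_def, map_add]

theorem induction_on' {q : TwistedGroupAlgebra c → Prop} (a : TwistedGroupAlgebra c)
    (zero : q 0) (add : ∀ a b, q a → q b → q (a + b)) (smul : ∀ (r : R) a, q a → q (r • a))
    (of : ∀ x, q (of c x)) : q a := by
  refine Finsupp.induction_linear (motive := q) a zero (fun a b ha hb => add a b ha hb)
    fun x r => ?_
  have h : (Finsupp.single x r : G →₀ R) = r • Finsupp.single x (1 : R) := by simp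
  rw [h]
  exact smul r _ (of x)

theorem zero_mul' (a : TwistedGroupAlgebra c) : 0 * a = 0 := by
  simp only [mul_def, map_zero, LinearMap.zero_apply]

theorem mul_zero' (a : TwistedGroupAlgebra c) : a * 0 = 0 := by
  simp only [mul_def, map_zero]

theorem mul_assoc' (a b d : TwistedGroupAlgebra c) : a * b * d = a * (b * d) := by
  induction a using induction_on' with
  | zero => simp only [zero_mul']
  | add a₁ a₂ h₁ h₂ => simp only [add_mul', h₁, h₂]
  | smul r a h => simp only [smul_mul', h]
  | of x =>
  induction b using induction_on' with
  | zero => simp only [zero_mul', mul_zero']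
  | add a₁ a₂ h₁ h₂ => simp only [add_mul', mul_add', h₁, h₂]
  | smul r a h => simp only [smul_mul', mul_smul', h]
  | of y =>
  induction d using induction_on' with
  | zero => simp only [mul_zero']
  | add a₁ a₂ h₁ h₂ => simp only [mul_add', h₁, h₂]
  | smul r a h => simp only [mul_smul', h]
  | of z =>
    rw [of_mul_of, smul_mul', of_mul_of, of_mul_of, mul_smul', of_mul_of, smul_smul, smul_smul,
      ← Units.val_mul, ← Units.val_mul, c.2 x y z, mul_assoc]

instance : Ring (TwistedGroupAlgebra c) :=
  { (inferInstance : AddCommGroup (TwistedGroupAlgebra c)),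
    (inferInstance : Mul (TwistedGroupAlgebra c)),
    (inferInstance : One (TwistedGroupAlgebra c)) with
    zero_mul := zero_mul'
    mul_zero := mul_zero'
    left_distrib := mul_add'
    right_distrib := add_mul'
    mul_assoc := mul_assoc'
    one_mul := one_mul'
    mul_one := mul_one' }

instance : Algebra R (TwistedGroupAlgebra c) :=
  Algebra.ofModule smul_mul' fun r a b => mul_smul' r a b

end TwistedGroupAlgebra

/-! ### Frobenius twists -/

/-- The twist of an `R`-algebra `A` by an automorphism `σ` of `R`: it equals `A` as a ring, and
`r : R` acts on it as `σ⁻¹ r` acts on `A`. For `σ` the `q`-power Frobenius automorphism this is the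
Frobenius twist `A^(q)`. -/
def AlgTwist {R : Type*} [CommRing R] (_σ : R ≃+* R) (A : Type*) : Type _ := A

namespace AlgTwist

variable {R : Type*} [CommRing R] (σ : R ≃+* R) (A : Type*) [Ring A] [Algebra R A]

instance : Ring (AlgTwist σ A) := inferInstanceAs (Ring A)

instance : Algebra R (AlgTwist σ A) := Algebra.compHom A (σ.symm : R →+* R)

/-- The identity map from `A` to its twist, as a ring isomorphism. -/
def toTwist : A ≃+* AlgTwist σ A := RingEquiv.refl A

theorem smul_toTwist (r : R) (a : A) : r • toTwist σ A a = toTwist σ A (σ.symm r • a) := rfl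

end AlgTwist

/-- The automorphism of the ring `W(k)` of Witt vectors that lifts the automorphism
`x ↦ x ^ (p ^ n)` of the perfect field `k`: the `n`-th power of the Frobenius automorphism. -/
def wittFrobenius (p : ℕ) [Fact p.Prime] (k : Type*) [Field k] [CharP k p] [PerfectRing k p]
    (n : ℕ) : WittVector p k ≃+* WittVector p k :=
  (WittVector.frobeniusEquiv p k : RingAut (WittVector p k)) ^ n

end

/-! ### Semilinear automorphisms of finite modules along a lift of Frobenius -/

/-! Write `R` for the coefficient ring and `σ` for its `p²`-power Frobenius. It suffices to find an
automorphism `θ` of `P ⋊ L` such that `σ ∘ c` and the pullback of `c` along `θ` are cohomologous;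
rescaled basis elements then give the isomorphism (`nonempty_algEquiv_algTwist`). The right `θ`
induces `x ↦ x ^ p` on `L`.

On cohomology: a class in `H²(L, kˣ)` is determined by its commutator pairing, since symmetric
cocycles with divisible values are coboundaries. The pairing is bilinear, so pulling back along `x ↦
x ^ p` multiplies the class by `p²`, exactly as `σ` does on `kˣ`. For `W(k)`, the units split as
Teichmüller representatives times principal units, and the latter are uniquely `|L|`-divisible, so
they contribute nothing (`mk_map_eq_mk_comap_pow`).

Existence of `θ`: one needs an automorphism of `P` semilinear along `x ↦ x ^ p` on `L`. View `P` as
a module over `A = (ℤ/pⁿ)[L]`, where this map induces a lift `F` of Frobenius. Such an `F` forces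
`A/p` to be reduced and preserves every ideal. Hence indecomposable finite modules are cyclic, and
`a • u ↦ F a • u` is well defined on them; direct sums give the general case
(`FrobeniusLift.exists_semilinear_addEquiv`). -/

theorem exists_isIdempotentElem_pow {A : Type*} [Monoid A] [Finite A] (a : A) :
    ∃ m : ℕ, IsIdempotentElem (a ^ (m + 1)) := by
  obtain ⟨i, j, hij, h⟩ := Finite.exists_ne_map_eq_of_infinite fun n : ℕ => a ^ n
  wlog hlt : i < j generalizing i j
  · exact this j i hij.symm h.symm (by omega)
  obtain ⟨d, rfl⟩ := Nat.exists_eq_add_of_lt hlt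
  have step (r t : ℕ) : a ^ (i + r + t * (d + 1)) = a ^ (i + r) := by
    induction t with
    | zero => simp
    | succ t ih =>
      calc a ^ (i + r + (t + 1) * (d + 1))
          = a ^ (i + d + 1) * a ^ (r + t * (d + 1)) := by rw [← pow_add]; ring_nf
        _ = a ^ i * a ^ (r + t * (d + 1)) := by rw [← show a ^ i = a ^ (i + d + 1) from h]
        _ = a ^ (i + r) := by rw [← pow_add, ← ih]; ring_nf
  -- The exponent is `(i + 1) * (d + 1)`: a positive multiple of the period `d + 1` that is at least
  -- the preperiod `i`.
  refine ⟨i + (i * d + d), ?_⟩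
  have h2 := step (i * d + d + 1) (i + 1)
  rw [IsIdempotentElem, ← pow_add]
  convert h2 using 2
  · ring
  · ring

namespace FrobeniusLift

variable {A : Type*} [CommRing A] {p : ℕ} (F : A ≃+* A)

/-- Modulo `p` the Frobenius is induced by the bijection `F`, hence is injective, so `A/p` is
reduced. -/
theorem dvd_of_isNilpotent (hF : ∀ a, (p : A) ∣ F a - a ^ p) (hp1 : 1 < p) {a : A}
    (ha : IsNilpotent a) : (p : A) ∣ a := by
  have key (n : ℕ) : ∀ a : A, a ^ p ^ n = 0 → (p : A) ∣ a := by
    induction n with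
    | zero => intro a h; simp_all
    | succ n ih =>
      intro a h
      have h1 : (p : A) ∣ a ^ p := ih _ (by rw [← pow_mul, ← pow_succ', h])
      have h2 : (p : A) ∣ F a := by simpa using dvd_add (hF a) h1
      simpa using map_dvd F.symm h2
  obtain ⟨n, hn⟩ := ha
  exact key n a (pow_eq_zero_of_le (Nat.lt_pow_self hp1).le hn)

/-- Since `e ^ p = e`, the idempotents `F e` and `e` differ by a multiple of the nilpotent `p`, and
commuting idempotents with nilpotent difference coincide. -/
theorem map_eq_of_isIdempotentElem (hF : ∀ a, (p : A) ∣ F a - a ^ p) (hp1 : 1 < p)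
    (hp : IsNilpotent (p : A)) {e : A} (he : IsIdempotentElem e) : F e = e := by
  refine eq_of_isNilpotent_sub_of_isIdempotentElem (he.map F) he ?_
  obtain ⟨b, hb⟩ := hF e
  rw [he.pow_eq (by omega)] at hb
  rw [hb]
  exact (Commute.all _ _).isNilpotent_mul_right hp

/-- Off the idempotent `a ^ (m + 1)` the element `a` is nilpotent, hence divisible by `p`. -/
theorem dvd_one_sub_pow_mul (hF : ∀ a, (p : A) ∣ F a - a ^ p) (hp1 : 1 < p) {a : A} {m : ℕ}
    (he : IsIdempotentElem (a ^ (m + 1))) : (p : A) ∣ (1 - a ^ (m + 1)) * a := by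
  refine dvd_of_isNilpotent F hF hp1 ⟨m + 1, ?_⟩
  rw [mul_pow, he.one_sub.pow_eq (by omega), sub_mul, he.eq, one_mul, sub_self]

/-- Every ideal is stable under a lift of Frobenius. -/
theorem dvd_map [Finite A] (hF : ∀ a, (p : A) ∣ F a - a ^ p) (hp1 : 1 < p)
    (hp : IsNilpotent (p : A)) (a : A) : a ∣ F a := by
  -- Divisibility is proved modulo `p ^ j`. With `e = a ^ (m + 1)`, the part `e * F a` is visibly a
  -- multiple of `a`; the other part is `p * F a'` with `p * a' = (1 - e) * a`, so approximating `F
  -- a'` gains one factor `p`.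
  have key (j : ℕ) : ∀ a : A, ∃ b t, F a = a * b + p ^ j * t := by
    induction j with
    | zero => exact fun a => ⟨0, F a, by simp⟩
    | succ j ih =>
      intro a
      obtain ⟨m, he⟩ := exists_isIdempotentElem_pow a
      obtain ⟨a', ha'⟩ := dvd_one_sub_pow_mul F hF hp1 he
      obtain ⟨b, t, hb⟩ := ih a'
      have hFe := map_eq_of_isIdempotentElem F hF hp1 hp he
      have h1 : (1 - a ^ (m + 1)) * F a = p * F a' := by
        have := congrArg F ha'
        rwa [map_mul, map_sub, map_one, hFe, map_mul, map_natCast] at this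
      refine ⟨a ^ m * F a + (1 - a ^ (m + 1)) * b, t, ?_⟩
      linear_combination h1 + (p : A) * hb - b * ha'
  obtain ⟨n, hn⟩ := hp
  obtain ⟨b, t, h⟩ := key n a
  exact ⟨b, by rw [h, hn, zero_mul, add_zero]⟩

/-! ### Finite modules over a ring with a Frobenius lift -/

section Modules

variable {M : Type*} [AddCommGroup M] [Module A M]

theorem isCompl_ker_lsmul {e : A} (he : IsIdempotentElem e) :
    IsCompl (LinearMap.ker (LinearMap.lsmul A M e))
      (LinearMap.ker (LinearMap.lsmul A M (1 - e))) := by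
  constructor
  · rw [Submodule.disjoint_def]
    intro x hx hy
    simp only [LinearMap.mem_ker, LinearMap.lsmul_apply, sub_smul, one_smul] at hx hy
    simpa [hx] using hy
  · rw [codisjoint_iff, Submodule.eq_top_iff']
    intro x
    refine Submodule.mem_sup.2 ⟨(1 - e) • x, ?_, e • x, ?_, by rw [← add_smul]; simp⟩
    · rw [LinearMap.mem_ker, LinearMap.lsmul_apply, smul_smul, mul_sub, mul_one, he.eq, sub_self,
        zero_smul]
    · rw [LinearMap.mem_ker, LinearMap.lsmul_apply, smul_smul, sub_mul, one_mul, he.eq, sub_self,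
        zero_smul]

/-- Over an indecomposable module, every scalar acts invertibly or as a multiple of `p`. -/
theorem smul_cases [Finite A] (hF : ∀ a, (p : A) ∣ F a - a ^ p) (hp1 : 1 < p)
    (hM : ∀ N N' : Submodule A M, IsCompl N N' → N = ⊥ ∨ N' = ⊥) (a : A) :
    (∃ b : A, ∀ x : M, b • a • x = x) ∨ ∃ b : A, ∀ x : M, a • x = (p : A) • b • x := by
  obtain ⟨m, he⟩ := exists_isIdempotentElem_pow a
  have hc := isCompl_ker_lsmul (M := M) he
  rcases hM _ _ hc with h | h <;> rw [h] at hc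
  · left
    refine ⟨a ^ m, fun x => ?_⟩
    have hx : x ∈ LinearMap.ker (LinearMap.lsmul A M (1 - a ^ (m + 1))) := by
      rw [eq_top_of_bot_isCompl hc]; trivial
    rw [LinearMap.mem_ker, LinearMap.lsmul_apply, sub_smul, one_smul, sub_eq_zero] at hx
    rw [smul_smul, ← pow_succ, ← hx]
  · right
    obtain ⟨b, hb⟩ := dvd_one_sub_pow_mul F hF hp1 he
    refine ⟨b, fun x => ?_⟩
    have hx : a • x ∈ LinearMap.ker (LinearMap.lsmul A M (a ^ (m + 1))) := by
      rw [eq_top_of_isCompl_bot hc]; trivial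
    rw [LinearMap.mem_ker, LinearMap.lsmul_apply] at hx
    rw [smul_smul, ← hb, mul_smul, sub_smul, one_smul, hx, sub_zero]

/-- As for abelian `p`-groups, a cyclic submodule generated by an element of maximal `p`-power order
is a direct summand; `smul_cases` lets scalars behave like integers. -/
theorem exists_span_singleton_eq_top [Finite A] [Finite M] (hF : ∀ a, (p : A) ∣ F a - a ^ p)
    (hp1 : 1 < p) (hp : IsNilpotent (p : A))
    (hM : ∀ N N' : Submodule A M, IsCompl N N' → N = ⊥ ∨ N' = ⊥) :
    ∃ u : M, Submodule.span A {u} = ⊤ := by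
  classical
  rcases subsingleton_or_nontrivial M with hs | hs
  · exact ⟨0, Subsingleton.elim _ _⟩
  have hex : ∃ n : ℕ, ∀ x : M, (p : A) ^ n • x = 0 := by
    obtain ⟨n, hn⟩ := hp
    exact ⟨n, fun x => by rw [hn, zero_smul]⟩
  obtain ⟨t, u, hu, ht⟩ : ∃ t : ℕ, ∃ u : M, (p : A) ^ t • u ≠ 0 ∧
      ∀ x : M, (p : A) ^ (t + 1) • x = 0 := by
    have h0 : Nat.find hex ≠ 0 := by
      intro h
      obtain ⟨x, hx⟩ := exists_ne (0 : M)
      have := Nat.find_spec hex x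
      rw [h, pow_zero, one_smul] at this
      exact hx this
    obtain ⟨t, ht⟩ := Nat.exists_eq_succ_of_ne_zero h0
    have := Nat.find_min hex (m := t) (by omega)
    push Not at this
    obtain ⟨u, hu⟩ := this
    exact ⟨t, u, hu, by simpa [ht] using Nat.find_spec hex⟩
  have hu0 : u ≠ 0 := by rintro rfl; simp at hu
  have hmem (a : A) : a • u ∈ Submodule.span A {u} :=
    Submodule.smul_mem _ _ (Submodule.mem_span_singleton_self u)
  obtain ⟨N, hN⟩ := (Set.toFinite {N : Submodule A M | Disjoint N (Submodule.span A {u})})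
    |>.exists_maximal ⟨⊥, disjoint_bot_left⟩
  have hdis : ∀ x ∈ N, x ∈ Submodule.span A {u} → x = 0 := Submodule.disjoint_def.1 hN.prop
  have hcompl : IsCompl N (Submodule.span A {u}) := by
    refine ⟨hN.prop, ?_⟩
    rw [codisjoint_iff]
    by_contra hne
    set S := N ⊔ Submodule.span A {u} with hS
    obtain ⟨v₀, hv₀⟩ : ∃ v, v ∉ S := by
      by_contra h; push Not at h; exact hne (Submodule.eq_top_iff'.2 h)
    have hexv : ∃ n : ℕ, (p : A) ^ n • v₀ ∈ S := ⟨t + 1, by rw [ht]; exact S.zero_mem⟩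
    obtain ⟨v, hv, hpv⟩ : ∃ v, v ∉ S ∧ (p : A) • v ∈ S := by
      have h0 : Nat.find hexv ≠ 0 := by
        intro h
        have := Nat.find_spec hexv
        rw [h, pow_zero, one_smul] at this
        exact hv₀ this
      obtain ⟨s, hs⟩ := Nat.exists_eq_succ_of_ne_zero h0
      refine ⟨(p : A) ^ s • v₀, Nat.find_min hexv (by omega), ?_⟩
      rw [smul_smul, ← pow_succ', ← Nat.succ_eq_add_one, ← hs]
      exact Nat.find_spec hexv
    obtain ⟨w, hw, z, hz, hwz⟩ := Submodule.mem_sup.1 hpv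
    obtain ⟨a, rfl⟩ := Submodule.mem_span_singleton.1 hz
    -- Here `p • v = w + a • u`. If `a` acted invertibly, multiplying by `p ^ t` would put `p ^ t •
    -- u` in `N`. So `a = p * b` on `M`, and `v` may be corrected to `v - b • u`, whose `p`-multiple
    -- lies in `N`.
    rcases smul_cases F hF hp1 hM a with ⟨b, hb⟩ | ⟨b, hb⟩
    · have h1 : (p : A) ^ t • w + (p : A) ^ t • a • u = 0 := by
        rw [← smul_add, hwz, smul_smul, ← pow_succ, ht]
      have h2 : (p : A) ^ t • a • u = 0 := by
        refine hdis _ ?_ (by rw [smul_smul]; exact hmem _)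
        rw [eq_neg_of_add_eq_zero_right h1]
        exact N.neg_mem (N.smul_mem _ hw)
      apply hu
      rw [← hb u, smul_comm _ b, h2, smul_zero]
    · have hpv' : (p : A) • (v - b • u) = w := by
        rw [smul_sub, ← hwz, hb, add_sub_cancel_right]
      have hv' : v - b • u ∉ S := fun h => hv <| by
        have := S.add_mem h ((le_sup_right : _ ≤ S) (hmem b))
        rwa [sub_add_cancel] at this
      have hnot : ¬ Disjoint (N ⊔ Submodule.span A {v - b • u}) (Submodule.span A {u}) := by
        intro h
        have := hN.le_of_ge h le_sup_left
        exact hv' ((le_sup_left : N ≤ S)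
          (this ((le_sup_right : Submodule.span A {v - b • u} ≤ _)
            (Submodule.mem_span_singleton_self _))))
      apply hnot
      rw [Submodule.disjoint_def]
      intro x hx hxu
      obtain ⟨w', hw', z', hz', rfl⟩ := Submodule.mem_sup.1 hx
      obtain ⟨d, rfl⟩ := Submodule.mem_span_singleton.1 hz'
      -- An invertible `d` would put `v - b • u` in `S`; otherwise `d • (v - b • u)` is already in
      -- `N`, so adjoining this vector keeps `N` disjoint from the span of `u`.
      rcases smul_cases F hF hp1 hM d with ⟨b', hb'⟩ | ⟨b', hb'⟩
      · exfalso
        apply hv'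
        rw [← hb' (v - b • u)]
        refine S.smul_mem _ ?_
        have := S.sub_mem ((le_sup_right : _ ≤ S) hxu) ((le_sup_left : N ≤ S) hw')
        rwa [add_sub_cancel_left] at this
      · refine hdis _ (N.add_mem hw' ?_) hxu
        rw [hb', smul_comm, hpv']
        exact N.smul_mem _ hw
  refine ⟨u, ?_⟩
  rcases hM _ _ hcompl with h | h
  · exact eq_top_of_bot_isCompl (h ▸ hcompl)
  · exact absurd (Submodule.span_singleton_eq_bot.1 h) hu0

theorem exists_semilinear_addEquiv_of_span_eq_top [Finite A] [Finite M]
    (hF : ∀ a, (p : A) ∣ F a - a ^ p) (hp1 : 1 < p) (hp : IsNilpotent (p : A)) {u : M}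
    (hu : Submodule.span A {u} = ⊤) :
    ∃ φ : M ≃+ M, ∀ (a : A) (x : M), φ (a • x) = F a • φ x := by
  have hg (x : M) : ∃ a : A, a • u = x := Submodule.mem_span_singleton.1 (hu ▸ trivial)
  choose g hg using hg
  -- The map is independent of the coefficient chosen because `F` preserves the annihilator of `u`,
  -- by `dvd_map`.
  have key (a : A) : F (g (a • u)) • u = F a • u := by
    obtain ⟨b, hb⟩ := dvd_map F hF hp1 hp (g (a • u) - a)
    rw [← sub_eq_zero, ← sub_smul, ← map_sub, hb, mul_comm, mul_smul, sub_smul, hg, sub_self,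
      smul_zero]
  let φ : M →+ M :=
    { toFun := fun x => F (g x) • u
      map_zero' := by simpa using key 0
      map_add' := fun x y => by
        have := key (g x + g y)
        rwa [add_smul, hg, hg, map_add, add_smul] at this }
  have hsurj : Function.Surjective φ := fun x =>
    ⟨F.symm (g x) • u, (key _).trans (by rw [F.apply_symm_apply, hg])⟩
  refine ⟨AddEquiv.ofBijective φ ⟨Finite.injective_iff_surjective.2 hsurj, hsurj⟩, fun a x => ?_⟩
  have := key (a * g x)
  rwa [mul_smul, hg, map_mul, mul_smul] at this

end Modules

theorem exists_semilinear_addEquiv [Finite A] (hF : ∀ a, (p : A) ∣ F a - a ^ p) (hp1 : 1 < p)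
    (hp : IsNilpotent (p : A)) (M : Type*) [AddCommGroup M] [Module A M] [Finite M] :
    ∃ φ : M ≃+ M, ∀ (a : A) (x : M), φ (a • x) = F a • φ x := by
  induction hn : Nat.card M using Nat.strong_induction_on generalizing M with
  | _ n ih =>
  by_cases hM : ∀ N N' : Submodule A M, IsCompl N N' → N = ⊥ ∨ N' = ⊥
  · obtain ⟨u, hu⟩ := exists_span_singleton_eq_top F hF hp1 hp hM
    exact exists_semilinear_addEquiv_of_span_eq_top F hF hp1 hp hu
  · push Not at hM
    obtain ⟨N, N', hc, hN, hN'⟩ := hM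
    have hlt {K : Submodule A M} (hK : K ≠ ⊤) : Nat.card K < n := by
      rw [← hn]
      obtain ⟨x, hx⟩ : ∃ x, x ∉ K := by
        by_contra h; push Not at h; exact hK (Submodule.eq_top_iff'.2 h)
      exact Finite.card_subtype_lt hx
    have hNt : N ≠ ⊤ := fun h => hN' (eq_bot_of_top_isCompl (h ▸ hc))
    have hNt' : N' ≠ ⊤ := fun h => hN (eq_bot_of_isCompl_top (h ▸ hc))
    obtain ⟨φ, hφ⟩ := ih _ (hlt hNt) N rfl
    obtain ⟨ψ, hψ⟩ := ih _ (hlt hNt') N' rfl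
    let E := Submodule.prodEquivOfIsCompl N N' hc
    refine ⟨(E.symm.toAddEquiv.trans (φ.prodCongr ψ)).trans E.toAddEquiv, fun a x => ?_⟩
    obtain ⟨y, rfl⟩ := E.surjective x
    simp [← map_smul, hφ, hψ, AddEquiv.prodCongr, Prod.smul_def]

end FrobeniusLift

/-! ### The Frobenius-semilinear automorphism of an abelian `p`-group -/

/-- The `p`-th power is additive modulo `p`, and on a monomial the claim is Fermat's little theorem
for the coefficient. -/
theorem MonoidAlgebra.natCast_dvd_domCongr_sub_pow {L : Type*} [CommGroup L] {p : ℕ}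
    (hp : p.Prime) (N : ℕ) (e : L ≃* L) (he : ∀ x, e x = x ^ p) (a : MonoidAlgebra (ZMod N) L) :
    (p : MonoidAlgebra (ZMod N) L) ∣ MonoidAlgebra.domCongr (ZMod N) (ZMod N) e a - a ^ p := by
  induction a using MonoidAlgebra.induction_linear with
  | zero => simp [hp.ne_zero]
  | add a b ha hb =>
    obtain ⟨r, hr⟩ := exists_add_pow_prime_eq hp a b
    have h : MonoidAlgebra.domCongr (ZMod N) (ZMod N) e (a + b) - (a + b) ^ p
        = (MonoidAlgebra.domCongr (ZMod N) (ZMod N) e a - a ^ p) +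
          (MonoidAlgebra.domCongr (ZMod N) (ZMod N) e b - b ^ p) - p * (a * b * r) := by
      rw [map_add, hr]; ring
    rw [h]
    exact dvd_sub (dvd_add ha hb) (dvd_mul_right _ _)
  | single x n =>
    obtain ⟨z, rfl⟩ := ZMod.intCast_surjective n
    have : Fact p.Prime := ⟨hp⟩
    obtain ⟨d, hd⟩ : (p : ℤ) ∣ z - z ^ p := by
      rw [← ZMod.intCast_zmod_eq_zero_iff_dvd]; simp
    refine ⟨MonoidAlgebra.single (x ^ p) (d : ZMod N), ?_⟩
    rw [MonoidAlgebra.domCongr_single, he, MonoidAlgebra.single_pow, ← nsmul_eq_mul,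
      MonoidAlgebra.smul_single, ← MonoidAlgebra.single_sub, nsmul_eq_mul]
    congr 1
    exact_mod_cast congrArg (Int.cast : ℤ → ZMod N) hd

theorem exists_addEquiv_semilinear_of_zmodModule {p : ℕ} (hp : p.Prime) (n : ℕ)
    {M L : Type*} [AddCommGroup M] [Finite M] [Module (ZMod (p ^ n)) M] [CommGroup L] [Finite L]
    (e : L ≃* L) (he : ∀ x, e x = x ^ p) (ρ : L →* AddMonoid.End M) :
    ∃ φ : M ≃+ M, ∀ x u, φ (ρ x u) = ρ (e x) (φ u) := by
  let A := MonoidAlgebra (ZMod (p ^ n)) L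
  have : NeZero (p ^ n) := ⟨pow_ne_zero _ hp.ne_zero⟩
  have : Finite A := Finite.of_injective (fun a : A => (a.coeff : L → ZMod (p ^ n))) fun a b h => by
    ext x; exact congrFun h x
  let r : L →* Module.End (ZMod (p ^ n)) M :=
    { toFun := fun x => (ρ x).toZModLinearMap (p ^ n)
      map_one' := by rw [map_one]; rfl
      map_mul' := fun x y => by rw [map_mul]; rfl }
  let R : A →ₐ[ZMod (p ^ n)] Module.End (ZMod (p ^ n)) M := MonoidAlgebra.lift _ _ _ r
  let : Module A M := Module.compHom _ R.toRingHom
  have hsmul (x : L) (u : M) : (MonoidAlgebra.single x 1 : A) • u = ρ x u := by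
    change R (MonoidAlgebra.single x 1) u = _
    rw [MonoidAlgebra.lift_single, one_smul]
    rfl
  obtain ⟨φ, hφ⟩ := FrobeniusLift.exists_semilinear_addEquiv (A := A) (p := p)
    (MonoidAlgebra.domCongr (ZMod (p ^ n)) (ZMod (p ^ n)) e : A ≃+* A)
    (fun a => MonoidAlgebra.natCast_dvd_domCongr_sub_pow hp _ e he a) hp.one_lt
    ⟨n, by
      rw [← Nat.cast_pow, ← map_natCast (algebraMap (ZMod (p ^ n)) A), ZMod.natCast_self,
        map_zero]⟩ M
  refine ⟨φ, fun x u => ?_⟩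
  rw [← hsmul, ← hsmul, hφ]
  exact congrArg (fun a : A => a • φ u) (MonoidAlgebra.domCongr_single (R := ZMod (p ^ n)) e x 1)

theorem IsPGroup.exists_mulEquiv_semilinear {p : ℕ} [Fact p.Prime] {P L : Type*} [CommGroup P]
    [Finite P] (hP : IsPGroup p P) [CommGroup L] [Finite L] (e : L ≃* L) (he : ∀ x, e x = x ^ p)
    (ρ : L →* MulAut P) : ∃ φ : P ≃* P, ∀ x u, φ (ρ x u) = ρ (e x) (φ u) := by
  obtain ⟨n, hn⟩ := IsPGroup.iff_card.1 hP
  let r : L →* AddMonoid.End (Additive P) :=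
    { toFun := fun x => MonoidHom.toAdditive (ρ x).toMonoidHom
      map_one' := by rw [map_one]; rfl
      map_mul' := fun x y => by rw [map_mul]; rfl }
  let : Module (ZMod (p ^ n)) (Additive P) := AddCommGroup.zmodModule fun x => by
    rw [← hn]; exact card_nsmul_eq_zero'
  obtain ⟨φ, hφ⟩ := exists_addEquiv_semilinear_of_zmodModule (p := p) Fact.out n e he r
  exact ⟨MulEquiv.toAdditive.symm φ, hφ⟩

theorem IsPGroup.exists_mulEquiv_semidirectProduct {p : ℕ} [Fact p.Prime] {P L : Type*}
    [CommGroup P] [Finite P] (hP : IsPGroup p P) [CommGroup L] [Finite L] (e : L ≃* L)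
    (he : ∀ x, e x = x ^ p) (ρ : L →* MulAut P) :
    ∃ θ : (P ⋊[ρ] L) ≃* (P ⋊[ρ] L), ∀ g, (θ g).right = e g.right := by
  obtain ⟨φ, hφ⟩ := hP.exists_mulEquiv_semilinear e he ρ
  exact ⟨SemidirectProduct.congr φ e fun x => by ext u; simp [hφ], fun _ => rfl⟩

/-! ### Second cohomology of finite abelian groups with trivial coefficients -/

namespace TrivCoeff

/-- Push-forward of 2-cocycles along a homomorphism of coefficient groups. -/
def Z2.map (G : Type*) {M N : Type*} [Group G] [CommGroup M] [CommGroup N] (f : M →* N) :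
    Z2 G M →* Z2 G N where
  toFun c := ⟨fun x y => f (c.1 x y), fun x y z => by
    simpa only [map_mul] using congrArg f (c.2 x y z)⟩
  map_one' := by ext; simp
  map_mul' _ _ := by ext; simp

variable {G H M N : Type*} [Group G] [Group H] [CommGroup M] [CommGroup N]

theorem mk_eq_mk_iff {c c' : Z2 G M} :
    (c : H2 G M) = c' ↔ ∃ f : G → M, ∀ x y, c'.1 x y = c.1 x y * (f x * f y * (f (x * y))⁻¹) := by
  rw [QuotientGroup.eq]
  constructor
  · rintro ⟨f, hf⟩
    refine ⟨f, fun x y => ?_⟩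
    have : c' = c * d1 G M f := by rw [hf]; group
    rw [this]; rfl
  · rintro ⟨f, hf⟩
    refine ⟨f, ?_⟩
    rw [eq_inv_mul_iff_mul_eq]
    ext x y
    exact (hf x y).symm

theorem mk_map_eq (f : M →* N) {c c' : Z2 G M} (h : (c : H2 G M) = c') :
    (Z2.map G f c : H2 G N) = Z2.map G f c' := by
  obtain ⟨g, hg⟩ := mk_eq_mk_iff.1 h
  exact mk_eq_mk_iff.2 ⟨f ∘ g, fun x y => by simp [Z2.map, hg]⟩

theorem mk_comap_eq (f : G →* H) {c c' : Z2 H M} (h : (c : H2 H M) = c') :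
    (Z2.comap M f c : H2 G M) = Z2.comap M f c' := by
  obtain ⟨g, hg⟩ := mk_eq_mk_iff.1 h
  exact mk_eq_mk_iff.2 ⟨g ∘ f, fun x y => by simp [Z2.comap, hg]⟩

/-! ### Symmetric cocycles and the commutator pairing -/

section Symmetric

variable {L : Type*} [CommGroup L]

theorem Z2.one_left (c : Z2 G M) (x : G) : c.1 1 x = c.1 1 1 := by
  simpa using (c.2 1 1 x).symm

/-- The extension of `L` by `M` defined by a 2-cocycle `c`. -/
@[ext]
structure CocycleExt (c : Z2 L M) where
  /-- The component in `M`. -/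
  fst : M
  /-- The component in `L`. -/
  snd : L

/-- The extension defined by a symmetric cocycle is commutative. -/
abbrev CocycleExt.commGroup (c : Z2 L M) (hc : ∀ x y, c.1 x y = c.1 y x) :
    CommGroup (CocycleExt c) where
  mul a b := ⟨a.1 * b.1 * c.1 a.2 b.2, a.2 * b.2⟩
  one := ⟨(c.1 1 1)⁻¹, 1⟩
  inv a := ⟨a.1⁻¹ * (c.1 a.2⁻¹ a.2)⁻¹ * (c.1 1 1)⁻¹, a.2⁻¹⟩
  mul_assoc a b d := by
    refine CocycleExt.ext ?_ (mul_assoc a.2 b.2 d.2)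
    change a.1 * b.1 * c.1 a.2 b.2 * d.1 * c.1 (a.2 * b.2) d.2 =
      a.1 * (b.1 * d.1 * c.1 b.2 d.2) * c.1 a.2 (b.2 * d.2)
    rw [mul_right_comm _ _ d.1, mul_assoc _ (c.1 a.2 b.2), c.2]
    simp only [mul_assoc]
  one_mul a := by
    refine CocycleExt.ext ?_ (one_mul a.2)
    change (c.1 1 1)⁻¹ * a.1 * c.1 1 a.2 = a.1
    rw [Z2.one_left c a.2, mul_right_comm, inv_mul_cancel, one_mul]
  mul_one a := by
    refine CocycleExt.ext ?_ (mul_one a.2)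
    change a.1 * (c.1 1 1)⁻¹ * c.1 a.2 1 = a.1
    rw [hc a.2, Z2.one_left c a.2, inv_mul_cancel_right]
  inv_mul_cancel a := by
    refine CocycleExt.ext ?_ (inv_mul_cancel a.2)
    change a.1⁻¹ * (c.1 a.2⁻¹ a.2)⁻¹ * (c.1 1 1)⁻¹ * a.1 * c.1 a.2⁻¹ a.2 = (c.1 1 1)⁻¹
    rw [mul_right_comm _ _ a.1, mul_right_comm a.1⁻¹, inv_mul_cancel, one_mul, mul_right_comm,
      inv_mul_cancel, one_mul]
  mul_comm a b := by
    refine CocycleExt.ext ?_ (mul_comm a.2 b.2)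
    change a.1 * b.1 * c.1 a.2 b.2 = b.1 * a.1 * c.1 b.2 a.2
    rw [hc, mul_comm a.1]

theorem exists_retraction_of_divisible {E : Type*} [CommGroup E]
    (hM : ∀ n : ℕ, n ≠ 0 → ∀ m : M, ∃ y, y ^ n = m) (i : M →* E) (hi : Function.Injective i) :
    ∃ r : E →* M, ∀ m, r (i m) = m := by
  let : DivisibleBy (Additive M) ℕ := divisibleByOfSMulRightSurj _ _ fun {n} hn m =>
    hM n hn m
  let : DivisibleBy (Additive M) ℤ := AddGroup.divisibleByIntOfDivisibleByNat _
  obtain ⟨r, hr⟩ := (Module.Baer.of_divisible (Additive M)).extension_property_addMonoidHom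
    (MonoidHom.toAdditive i) hi (AddMonoidHom.id _)
  exact ⟨MonoidHom.toAdditive.symm r, fun m => DFunLike.congr_fun hr (Additive.ofMul m)⟩

/-- A symmetric cocycle with values in a divisible group is a coboundary. -/
theorem Z2.exists_eq_of_symmetric (hM : ∀ n : ℕ, n ≠ 0 → ∀ m : M, ∃ y, y ^ n = m) (c : Z2 L M)
    (hc : ∀ x y, c.1 x y = c.1 y x) : ∃ f : L → M, ∀ x y, c.1 x y = f x * f y * (f (x * y))⁻¹ := by
  let : CommGroup (CocycleExt c) := CocycleExt.commGroup c hc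
  have mul_def (a b : CocycleExt c) : a * b = ⟨a.1 * b.1 * c.1 a.2 b.2, a.2 * b.2⟩ := rfl
  -- The factor `(c.1 1 1)⁻¹` is needed because cocycles are not normalised. A retraction `r` of `i`
  -- evaluated on the lifts `⟨1, x⟩` gives the cochain.
  let i : M →* CocycleExt c := MonoidHom.mk' (fun m => ⟨m * (c.1 1 1)⁻¹, 1⟩) fun a b => by
    rw [mul_def]
    refine CocycleExt.ext ?_ (mul_one 1).symm
    change a * b * (c.1 1 1)⁻¹ = a * (c.1 1 1)⁻¹ * (b * (c.1 1 1)⁻¹) * c.1 1 1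
    rw [← mul_assoc, inv_mul_cancel_right, mul_right_comm]
  have hi : Function.Injective i := fun a b h => mul_right_cancel (congrArg CocycleExt.fst h)
  obtain ⟨r, hr⟩ := exists_retraction_of_divisible hM i hi
  refine ⟨fun x => r ⟨1, x⟩, fun x y => ?_⟩
  beta_reduce
  rw [eq_mul_inv_iff_mul_eq, ← hr (c.1 x y), ← map_mul, ← map_mul, mul_def, mul_def]
  congr 1
  refine CocycleExt.ext ?_ (one_mul _)
  change c.1 x y * (c.1 1 1)⁻¹ * 1 * c.1 1 (x * y) = 1 * 1 * c.1 x y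
  rw [Z2.one_left c (x * y)]
  simp

/-- The commutator pairing of a cocycle on an abelian group. -/
def Z2.comm (c : Z2 L M) (x y : L) : M := c.1 x y / c.1 y x

theorem Z2.comm_mul_left (c : Z2 L M) (x y z : L) :
    Z2.comm c (x * y) z = Z2.comm c x z * Z2.comm c y z := by
  have h1 := c.2 x y z
  have h2 := c.2 z x y
  have h3 := c.2 x z y
  rw [mul_comm z x] at h2
  rw [mul_comm z y] at h3
  simp only [Z2.comm, div_mul_div_comm]
  rw [div_eq_div_iff_mul_eq_mul]
  -- Bilinearity is the product of the cocycle identities at `(x, y, z)` and `(z, x, y)` with the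
  -- inverse of the one at `(x, z, y)`; the factor here collects the terms that cancel.
  apply mul_left_cancel (a := c.1 x y * c.1 (x * z) y * c.1 x (y * z))
  calc _ = (c.1 x y * c.1 (x * y) z) * (c.1 z x * c.1 (x * z) y) * (c.1 z y * c.1 x (y * z)) := by
        simp only [mul_assoc, mul_comm, mul_left_comm]
    _ = (c.1 y z * c.1 x (y * z)) * (c.1 x y * c.1 z (x * y)) * (c.1 x z * c.1 (x * z) y) := by
        rw [h1, h2, h3]
    _ = _ := by simp only [mul_assoc, mul_comm, mul_left_comm]

theorem Z2.comm_swap (c : Z2 L M) (x y : L) : Z2.comm c x y = (Z2.comm c y x)⁻¹ := by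
  simp [Z2.comm]

theorem Z2.comm_pow_left (c : Z2 L M) (x y : L) (n : ℕ) : Z2.comm c (x ^ n) y = Z2.comm c x y ^ n :=
  map_pow (MonoidHom.mk' (fun x => Z2.comm c x y) fun x z => Z2.comm_mul_left c x z y) x n

theorem Z2.comm_pow_pow (c : Z2 L M) (x y : L) (n : ℕ) :
    Z2.comm c (x ^ n) (y ^ n) = Z2.comm c x y ^ (n ^ 2) := by
  rw [Z2.comm_pow_left, Z2.comm_swap, Z2.comm_pow_left, Z2.comm_swap c y x, inv_pow, inv_pow, inv_pow,
    inv_inv, ← pow_mul, sq]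

/-- Pulling back along `x ↦ x ^ n` multiplies a class by `n ^ 2` if the coefficients are
divisible. -/
theorem mk_comap_pow_eq (hM : ∀ n : ℕ, n ≠ 0 → ∀ m : M, ∃ y, y ^ n = m) (c : Z2 L M) (n : ℕ) :
    (Z2.comap M (powMonoidHom n) c : H2 L M) = Z2.map L (powMonoidHom (n ^ 2)) c := by
  let c₁ := Z2.comap M (powMonoidHom n) c
  let c₂ := Z2.map L (powMonoidHom (n ^ 2)) c
  -- Both cocycles have the `n ^ 2`-th power of the pairing of `c` as commutator pairing, so their
  -- quotient is symmetric.
  obtain ⟨f, hf⟩ := Z2.exists_eq_of_symmetric hM (c₁⁻¹ * c₂) fun x y => by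
    have h := Z2.comm_pow_pow c x y n
    rw [Z2.comm, Z2.comm, div_pow, div_eq_div_iff_mul_eq_mul] at h
    change (c.1 (x ^ n) (y ^ n))⁻¹ * c.1 x y ^ n ^ 2 = (c.1 (y ^ n) (x ^ n))⁻¹ * c.1 y x ^ n ^ 2
    rw [inv_mul_eq_iff_eq_mul, mul_left_comm, eq_inv_mul_iff_mul_eq, mul_comm, ← h, mul_comm]
  refine mk_eq_mk_iff.2 ⟨f, fun x y => ?_⟩
  rw [← hf]
  exact (mul_inv_cancel_left _ _).symm

end Symmetric

/-- A cocycle on a finite group of order `n` is a coboundary with values in `U` if its values lie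
in a subgroup `U` on which raising to the power `n` is bijective. -/
theorem Z2.exists_eq_of_bijective_pow [Finite G] (U : Subgroup M)
    (hU : Function.Bijective fun u : U => u ^ Nat.card G) (c : Z2 G M)
    (hc : ∀ x y, c.1 x y ∈ U) : ∃ f : G → M, ∀ x y, c.1 x y = f x * f y * (f (x * y))⁻¹ := by
  classical
  have := Fintype.ofFinite G
  let u (x y : G) : U := ⟨c.1 x y, hc x y⟩
  have hu (x y z : G) : u x y * u (x * y) z = u y z * u x (y * z) := Subtype.ext (c.2 x y z)
  -- Multiplying the cocycle identity over all `z` shows that the `|G|`-th power of `c` is the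
  -- coboundary of `F`; unique roots in `U` then remove the power.
  let F (x : G) : U := ∏ z, u x z
  choose f hf using hU.2
  have hF (x y : G) : u x y ^ Nat.card G * F (x * y) = F y * F x := by
    have := Finset.prod_congr (rfl : (Finset.univ : Finset G) = _) fun z _ => hu x y z
    rw [Finset.prod_mul_distrib, Finset.prod_mul_distrib, Finset.prod_const, Finset.card_univ,
      ← Nat.card_eq_fintype_card] at this
    exact this.trans (congrArg _ (Equiv.prod_comp (Equiv.mulLeft y) (u x)))
  refine ⟨fun x => f (F x), fun x y => ?_⟩
  have key : u x y = f (F x) * f (F y) * (f (F (x * y)))⁻¹ := hU.1 <| by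
    simp only [mul_pow, inv_pow]
    have hf' (v : U) : f v ^ Nat.card G = v := hf v
    rw [hf', hf', hf', eq_mul_inv_iff_mul_eq, hF, mul_comm]
  exact congrArg Subtype.val key

/-- Suppose that `π : M → N` has a section `τ`, and that raising to the power `|G|` is bijective
on the kernel of `π`. Then every class comes from `N`. -/
theorem mk_eq_mk_map_section [Finite G] (π : M →* N) (τ : N →* M) (hτ : ∀ x, π (τ x) = x)
    (hU : Function.Bijective fun u : π.ker => u ^ Nat.card G) (c : Z2 G M) :
    (c : H2 G M) = Z2.map G τ (Z2.map G π c) := by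
  obtain ⟨f, hf⟩ := Z2.exists_eq_of_bijective_pow π.ker hU (c⁻¹ * Z2.map G τ (Z2.map G π c))
    fun x y => by
      change π ((c.1 x y)⁻¹ * τ (π (c.1 x y))) = 1
      rw [map_mul, map_inv, hτ, inv_mul_cancel]
  refine mk_eq_mk_iff.2 ⟨f, fun x y => ?_⟩
  rw [← hf]
  exact (mul_inv_cancel_left _ _).symm

/-- If `σ` acts on the image of the section `τ` as raising to the power `n ^ 2`, then on the second
cohomology of an abelian group it acts as pulling back along `x ↦ x ^ n`. -/
theorem mk_map_eq_mk_comap_pow {L : Type*} [CommGroup L] [Finite L] (π : M →* N) (τ : N →* M)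
    (hτ : ∀ x, π (τ x) = x) (hU : Function.Bijective fun u : π.ker => u ^ Nat.card L)
    (hN : ∀ n : ℕ, n ≠ 0 → ∀ m : N, ∃ y, y ^ n = m) (n : ℕ) (σ : M →* M)
    (hσ : ∀ x, σ (τ x) = τ (x ^ n ^ 2)) (c : Z2 L M) :
    (Z2.map L σ c : H2 L M) = Z2.comap M (powMonoidHom n) c := by
  have h := mk_eq_mk_map_section π τ hτ hU c
  rw [mk_map_eq σ h, mk_comap_eq (powMonoidHom n) h]
  have h2 := mk_map_eq τ (mk_comap_pow_eq hN (Z2.map L π c) n)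
  refine Eq.trans ?_ h2.symm
  congr 1
  ext x y
  exact hσ _

end TrivCoeff

/-! ### Isomorphisms of twisted group algebras with their twists -/

namespace TwistedGroupAlgebra

open TrivCoeff

variable {G R : Type*} [Group G] [CommRing R] (c : Z2 G Rˣ) (σ : R ≃+* R) (θ : G ≃* G) (f : G → Rˣ)

/-- The coefficient at `[x]` of an element of a twisted group algebra. -/
noncomputable def coeffAt (x : G) : TwistedGroupAlgebra c →ₗ[R] R := Finsupp.lapply x

theorem coeffAt_of [DecidableEq G] (x y : G) : coeffAt c x (of c y) = if y = x then 1 else 0 :=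
  Finsupp.single_apply

/-- The `R`-linear map from a twisted group algebra to its twist with `[x] ↦ f(x) [θ x]`. -/
noncomputable def twistMap : TwistedGroupAlgebra c →ₗ[R] AlgTwist σ (TwistedGroupAlgebra c) :=
  Finsupp.linearCombination R fun x =>
    AlgTwist.toTwist σ (TwistedGroupAlgebra c) ((f x : R) • of c (θ x))

theorem twistMap_of (x : G) :
    twistMap c σ θ f (of c x) = AlgTwist.toTwist σ _ ((f x : R) • of c (θ x)) :=
  (Finsupp.linearCombination_single _ _ _).trans (one_smul _ _)

theorem twistMap_bijective : Function.Bijective (twistMap c σ θ f) := by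
  constructor
  · classical
    have key (a : TwistedGroupAlgebra c) (x : G) :
        coeffAt c (θ x) ((AlgTwist.toTwist σ _).symm (twistMap c σ θ f a)) =
          f x * σ.symm (coeffAt c x a) := by
      induction a using induction_on' with
      | zero => simp only [map_zero, mul_zero]
      | add a b ha hb => simp only [map_add, ha, hb, mul_add]
      | smul r a ha =>
        obtain ⟨b, hb⟩ := (AlgTwist.toTwist σ _).surjective (twistMap c σ θ f a)
        rw [map_smul (twistMap c σ θ f), map_smul (coeffAt c x), smul_eq_mul, map_mul,
          mul_left_comm, ← ha, ← hb,
          AlgTwist.smul_toTwist, RingEquiv.symm_apply_apply, RingEquiv.symm_apply_apply, map_smul,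
          smul_eq_mul]
      | of y =>
        rw [twistMap_of, RingEquiv.symm_apply_apply, map_smul, coeffAt_of, coeffAt_of]
        by_cases h : y = x
        · simp [h]
        · simp [h]
    intro a b h
    refine Finsupp.ext fun x => σ.symm.injective ((f x).isUnit.mul_left_cancel ?_)
    exact (key a x).symm.trans ((congrArg _ (congrArg _ h)).trans (key b x))
  · intro b
    change TwistedGroupAlgebra c at b
    induction b using induction_on' with
    | zero => exact ⟨0, map_zero _⟩
    | add a b ha hb =>
      obtain ⟨a', ha⟩ := ha
      obtain ⟨b', hb⟩ := hb
      exact ⟨a' + b', by rw [map_add, ha, hb]; rfl⟩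
    | smul r a ha =>
      obtain ⟨a', ha⟩ := ha
      refine ⟨σ r • a', ?_⟩
      rw [map_smul, ha]
      refine (AlgTwist.smul_toTwist σ (TwistedGroupAlgebra c) (σ r) a).trans ?_
      rw [σ.symm_apply_apply]; rfl
    | of y =>
      refine ⟨σ ((f (θ.symm y))⁻¹ : Rˣ) • of c (θ.symm y), ?_⟩
      rw [map_smul, twistMap_of, AlgTwist.smul_toTwist, σ.symm_apply_apply, smul_smul,
        Units.inv_mul, one_smul, θ.apply_symm_apply]
      rfl

variable {c σ θ f}

theorem twistMap_mul
    (h : ∀ x y, σ.symm (c.1 x y) * f (x * y) = f x * f y * c.1 (θ x) (θ y))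
    (a b : TwistedGroupAlgebra c) :
    twistMap c σ θ f (a * b) = twistMap c σ θ f a * twistMap c σ θ f b := by
  induction a using induction_on' with
  | zero => rw [zero_mul, map_zero, zero_mul]
  | add a₁ a₂ h₁ h₂ => rw [add_mul, map_add, h₁, h₂, map_add, add_mul]
  | smul r a h => rw [smul_mul', map_smul, h, map_smul, smul_mul_assoc]
  | of x =>
  induction b using induction_on' with
  | zero => rw [mul_zero, map_zero, mul_zero]
  | add a₁ a₂ h₁ h₂ => rw [mul_add, map_add, h₁, h₂, map_add, mul_add]
  | smul r a h => rw [mul_smul', map_smul, h, map_smul, mul_smul_comm]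
  | of y =>
    rw [of_mul_of, map_smul, twistMap_of, twistMap_of, twistMap_of, ← map_mul,
      AlgTwist.smul_toTwist, smul_smul, h, smul_mul', mul_smul', of_mul_of, smul_smul, smul_smul,
      map_mul, mul_assoc]

/-- A surjective multiplicative map sends the identity to an identity, which spares evaluating the
cochain at `1`. -/
theorem twistMap_one
    (h : ∀ x y, σ.symm (c.1 x y) * f (x * y) = f x * f y * c.1 (θ x) (θ y)) :
    twistMap c σ θ f 1 = 1 := by
  obtain ⟨a, ha⟩ := (twistMap_bijective c σ θ f).2 1
  have := twistMap_mul h 1 a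
  rwa [one_mul, ha, mul_one, eq_comm] at this

theorem nonempty_algEquiv_algTwist (θ : G ≃* G)
    (h : (Z2.map G (Units.map (σ : R →* R)) c : H2 G Rˣ) = Z2.comap Rˣ θ.toMonoidHom c) :
    Nonempty (TwistedGroupAlgebra c ≃ₐ[R] AlgTwist σ (TwistedGroupAlgebra c)) := by
  -- Scalars of the twist act through `σ⁻¹`, so the relation is moved to one between `σ⁻¹ ∘ c` and
  -- the pullback of `c` along `θ⁻¹`.
  have h' := mk_comap_eq θ.symm.toMonoidHom (mk_map_eq (Units.map (σ.symm : R →* R)) h)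
  obtain ⟨g, hg⟩ := mk_eq_mk_iff.1 h'
  have hf (x y : G) :
      σ.symm (c.1 x y) * g (x * y) = g x * g y * c.1 (θ.symm x) (θ.symm y) := by
    have h1 : Units.map (σ.symm : R →* R) (c.1 x y) =
        c.1 (θ.symm x) (θ.symm y) * (g x * g y * (g (x * y))⁻¹) := by
      simpa [Z2.map, Z2.comap, Units.ext_iff] using hg x y
    have h2 := congrArg Units.val (mul_inv_eq_iff_eq_mul.1 ((mul_assoc _ _ _).trans h1.symm))
    rw [Units.val_mul, Units.val_mul, Units.val_mul, mul_comm] at h2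
    exact h2.symm
  exact ⟨AlgEquiv.ofBijective
    (AlgHom.ofLinearMap (twistMap c σ θ.symm g) (twistMap_one hf) (twistMap_mul hf))
    (twistMap_bijective c σ θ.symm g)⟩

end TwistedGroupAlgebra

/-! ### Units of Witt vectors -/

namespace WittVector

variable {p : ℕ} [Fact p.Prime] {k : Type*} [Field k] [CharP k p]

theorem natCast_ne_zero_of_coprime {n : ℕ} (hn : n.Coprime p) : (n : k) ≠ 0 := by
  rw [Ne, CharP.cast_eq_zero_iff k p]
  exact fun h => (Fact.out : p.Prime).one_lt.ne' (Nat.dvd_one.1 (hn ▸ Nat.dvd_gcd h dvd_rfl))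

/-- In the domain `W(k)`, the cofactor of `v - w` in `v ^ n - w ^ n` has constant coefficient `n ≠
0` in `k`. -/
theorem pow_injective_of_constantCoeff_eq_one {n : ℕ} (hn : n.Coprime p) {v w : WittVector p k}
    (hv : constantCoeff v = 1) (hw : constantCoeff w = 1) (h : v ^ n = w ^ n) : v = w := by
  have h1 : (∑ i ∈ Finset.range n, v ^ i * w ^ (n - 1 - i)) * (v - w) = 0 := by
    rw [geom_sum₂_mul, h, sub_self]
  refine sub_eq_zero.1 ((mul_eq_zero.1 h1).resolve_left fun h2 => ?_)
  have h3 := congrArg constantCoeff h2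
  simp only [map_sum, map_mul, map_pow, hv, hw, one_pow, mul_one, Finset.sum_const,
    Finset.card_range, nsmul_eq_mul, map_zero] at h3
  exact natCast_ne_zero_of_coprime hn h3

theorem exists_pow_eq_of_constantCoeff_eq_one [PerfectRing k p] {n : ℕ} (hn : n.Coprime p)
    {u : WittVector p k} (hu : constantCoeff u = 1) :
    ∃ v : WittVector p k, v ^ n = u ∧ constantCoeff v = 1 := by
  have hn0 : n ≠ 0 := by
    rintro rfl
    exact (Fact.out : p.Prime).one_lt.ne' (by simpa using hn)
  have hmem (x : WittVector p k) :
      x ∈ Ideal.span {(p : WittVector p k)} ↔ constantCoeff x = 0 := by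
    rw [← ker_constantCoeff, RingHom.mem_ker]
  -- Hensel's lemma for `X ^ n - u` at the approximate root `1`, where the derivative `n` is a unit.
  obtain ⟨v, hv, hv1⟩ := HenselianRing.is_henselian (I := Ideal.span {(p : WittVector p k)})
    (Polynomial.X ^ n - Polynomial.C u) (Polynomial.monic_X_pow_sub_C u hn0) 1
    ((hmem _).2 (by
      rw [Polynomial.eval_sub, Polynomial.eval_pow, Polynomial.eval_X, Polynomial.eval_C, one_pow,
        map_sub, hu, map_one, sub_self]))
    (by
      refine IsUnit.map _ (isUnit_of_coeff_zero_ne_zero _ ?_)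
      rw [← constantCoeff_apply, Polynomial.derivative_sub, Polynomial.derivative_X_pow,
        Polynomial.derivative_C, sub_zero, Polynomial.eval_mul, Polynomial.eval_C,
        Polynomial.eval_pow, Polynomial.eval_X, one_pow, mul_one, map_natCast]
      exact natCast_ne_zero_of_coprime hn)
  refine ⟨v, ?_, ?_⟩
  · simpa [sub_eq_zero] using hv
  · rw [hmem, map_sub, map_one, sub_eq_zero] at hv1
    exact hv1

/-- Raising to a power prime to `p` is bijective on the principal units of `W(k)`. -/
theorem bijective_pow_ker_constantCoeff [PerfectRing k p] {n : ℕ} (hn : n.Coprime p) :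
    Function.Bijective fun u : (Units.map
      (constantCoeff : WittVector p k →+* k).toMonoidHom).ker => u ^ n := by
  have hcoe (u : (Units.map (constantCoeff : WittVector p k →+* k).toMonoidHom).ker) :
      constantCoeff (u.1 : WittVector p k) = 1 := congrArg Units.val u.2
  constructor
  · intro u v h
    refine Subtype.ext (Units.ext (pow_injective_of_constantCoeff_eq_one hn (hcoe u) (hcoe v) ?_))
    exact congrArg (fun w => ((w : (WittVector p k)ˣ) : WittVector p k)) (congrArg Subtype.val h)
  · intro u
    obtain ⟨v, hv, hv1⟩ := exists_pow_eq_of_constantCoeff_eq_one hn (hcoe u)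
    have hvu : IsUnit v := isUnit_of_coeff_zero_ne_zero _ (by
      rw [← constantCoeff_apply, hv1]; exact one_ne_zero)
    exact ⟨⟨hvu.unit, Units.ext hv1⟩, Subtype.ext (Units.ext hv)⟩

end WittVector

theorem WittVector.constantCoeff_teichmuller {p : ℕ} [Fact p.Prime] {R : Type*} [CommRing R]
    (x : R) : constantCoeff (teichmuller p x) = x :=
  teichmuller_coeff_zero p x

theorem wittFrobenius_teichmuller (p : ℕ) [Fact p.Prime] (k : Type*) [Field k] [CharP k p]
    [PerfectRing k p] (n : ℕ) (x : k) :
    wittFrobenius p k n (WittVector.teichmuller p x) = WittVector.teichmuller p (x ^ p ^ n) := by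
  induction n with
  | zero => simp [wittFrobenius]
  | succ n ih =>
    have h : wittFrobenius p k (n + 1) (WittVector.teichmuller p x) =
        WittVector.frobenius (wittFrobenius p k n (WittVector.teichmuller p x)) := by
      rw [wittFrobenius, pow_succ']; rfl
    rw [h, ih, WittVector.frobenius_eq_map_frobenius, WittVector.map_teichmuller, frobenius_def,
      ← pow_mul, ← pow_succ]

/-! ### The main theorem -/

theorem IsAlgClosed.exists_units_pow_eq (k : Type*) [Field k] [IsAlgClosed k] {n : ℕ} (hn : n ≠ 0)
    (u : kˣ) : ∃ v : kˣ, v ^ n = u := by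
  obtain ⟨z, hz⟩ := IsAlgClosed.exists_pow_nat_eq (u : k) (Nat.pos_of_ne_zero hn)
  have hz0 : z ≠ 0 := by
    rintro rfl
    exact u.ne_zero (by rw [← hz, zero_pow hn])
  exact ⟨Units.mk0 z hz0, Units.ext hz⟩

open TrivCoeff in
/-- The isomorphism with the twist over a ring `R` whose units map onto `kˣ` with a section `τ`
that intertwines `σ` with raising to the power `p ^ 2`. -/
theorem TwistedGroupAlgebra.nonempty_algEquiv_algTwist_semidirectProduct {p : ℕ} [Fact p.Prime]
    {k R : Type*} [Field k] [IsAlgClosed k] [CommRing R] (σ : R ≃+* R) (π : Rˣ →* kˣ)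
    (τ : kˣ →* Rˣ) (hτ : ∀ x, π (τ x) = x)
    (hσ : ∀ x, Units.map (σ : R →* R) (τ x) = τ (x ^ p ^ 2))
    {P L : Type*} [CommGroup P] [Finite P] (hP : IsPGroup p P) [CommGroup L] [Finite L]
    (hL : (Nat.card L).Coprime p) (hU : Function.Bijective fun u : π.ker => u ^ Nat.card L)
    (ρ : L →* MulAut P) (α : H2 L Rˣ) (c : Z2 (P ⋊[ρ] L) Rˣ)
    (hc : (c : H2 (P ⋊[ρ] L) Rˣ) = H2.comap Rˣ SemidirectProduct.rightHom α) :
    Nonempty (TwistedGroupAlgebra c ≃ₐ[R] AlgTwist σ (TwistedGroupAlgebra c)) := by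
  obtain ⟨a, rfl⟩ := QuotientGroup.mk_surjective α
  replace hc : (c : H2 (P ⋊[ρ] L) Rˣ) =
      (Z2.comap Rˣ SemidirectProduct.rightHom a : Z2 (P ⋊[ρ] L) Rˣ) := hc
  -- Coprimality of `|L|` and `p` makes `x ↦ x ^ p` an automorphism of the abelian group `L`.
  let e : L ≃* L := MulEquiv.ofBijective (powMonoidHom p) (powCoprime hL).bijective
  obtain ⟨θ, hθ⟩ := hP.exists_mulEquiv_semidirectProduct e (fun _ => rfl) ρ
  refine nonempty_algEquiv_algTwist θ ?_
  have ha := mk_comap_eq (SemidirectProduct.rightHom : P ⋊[ρ] L →* L)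
    (mk_map_eq_mk_comap_pow π τ hτ hU (fun n hn => IsAlgClosed.exists_units_pow_eq k hn) p
      (Units.map (σ : R →* R)) hσ a)
  refine (mk_map_eq _ hc).trans (ha.trans (Eq.trans ?_ (mk_comap_eq θ.toMonoidHom hc).symm))
  congr 1
  ext x y
  change ((a.1 (x.right ^ p) (y.right ^ p) : Rˣ) : R) = a.1 (θ x).right (θ y).right
  rw [hθ, hθ]
  rfl

/-- Twisted group algebras `O_α(P ⋊ L)`, for `O = k` and for `O = W(k)`, are isomorphic as
`O`-algebras to their second Frobenius twists. Here `α ∈ H²(L, Oˣ)` is inflated to `P ⋊ L`, and `c`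
is an arbitrary 2-cocycle on `P ⋊ L` that represents the inflated class. -/
theorem theorem1p1 (p : ℕ) [Fact p.Prime] (k : Type*) [Field k] [IsAlgClosed k] [CharP k p]
    (P : Type*) [CommGroup P] [Finite P] (hP : IsPGroup p P)
    (L : Subgroup (MulAut P)) (hLcomm : IsMulCommutative L) (hLp : (Nat.card L).Coprime p) :
    (∀ (α : TrivCoeff.H2 L kˣ) (c : TrivCoeff.Z2 (P ⋊[L.subtype] L) kˣ),
      (c : TrivCoeff.H2 (P ⋊[L.subtype] L) kˣ) =
          TrivCoeff.H2.comap kˣ SemidirectProduct.rightHom α →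
        Nonempty (TwistedGroupAlgebra c ≃ₐ[k]
          AlgTwist (iterateFrobeniusEquiv k p 2) (TwistedGroupAlgebra c))) ∧
    (∀ (α : TrivCoeff.H2 L (WittVector p k)ˣ)
      (c : TrivCoeff.Z2 (P ⋊[L.subtype] L) (WittVector p k)ˣ),
      (c : TrivCoeff.H2 (P ⋊[L.subtype] L) (WittVector p k)ˣ) =
          TrivCoeff.H2.comap (WittVector p k)ˣ SemidirectProduct.rightHom α →
        Nonempty (TwistedGroupAlgebra c ≃ₐ[WittVector p k]
          AlgTwist (wittFrobenius p k 2) (TwistedGroupAlgebra c))) := by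
  let : CommGroup L := { mul_comm := hLcomm.is_comm.comm }
  have : Finite (MulAut P) := Finite.of_injective (fun f : MulAut P => (f : P → P))
    DFunLike.coe_injective
  constructor
  · intro α c hc
    -- Over `k` both `π` and `τ` are the identity, so the condition on the kernel is void.
    have : Subsingleton (MonoidHom.id kˣ).ker := ⟨fun u v => Subtype.ext (u.2.trans v.2.symm)⟩
    exact TwistedGroupAlgebra.nonempty_algEquiv_algTwist_semidirectProduct (p := p)
      (iterateFrobeniusEquiv k p 2) (MonoidHom.id kˣ) (MonoidHom.id kˣ) (fun _ => rfl)
      (fun x => Units.ext (iterateFrobeniusEquiv_apply k p 2 (x : k))) hP hLp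
      ⟨fun _ _ _ => Subsingleton.elim _ _, fun u => ⟨u, Subsingleton.elim _ _⟩⟩
      L.subtype α c hc
  · intro α c hc
    exact TwistedGroupAlgebra.nonempty_algEquiv_algTwist_semidirectProduct (p := p)
      (wittFrobenius p k 2) (Units.map (WittVector.constantCoeff (p := p)).toMonoidHom)
      (Units.map (WittVector.teichmuller p))
      (fun x => Units.ext (WittVector.constantCoeff_teichmuller (x : k)))
      (fun x => Units.ext ((wittFrobenius_teichmuller p k 2 (x : k)).trans
        (by simp))) hP hLp
      (WittVector.bijective_pow_ker_constantCoeff hLp) L.subtype α c hc
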